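/- Let $S\in\mathbb{R}^{n\times n}$ be any diffusion operator, $X\in\mathbb{R}^{n\times m}$ a feature matrix, $c_\sigma\ge 0$, and let $\sigma(x)=\max(x,0)$ be the ReLU activation with derivative $\dot\sigma$. For $i\ge 1$ define $$\Sigma_1 = SXX^TS^T,\qquad \Sigma_{i+1}=S E_i S^T,\qquad E_i = c_\sigma\,\mathbb{E}_{f\sim\mathcal N(0,\Sigma_i)}[\sigma(f)\sigma(f)^T],\qquad \dot E_i = c_\sigma\,\mathbb{E}_{f\sim\mathcal N(0,\Sigma_i)}[\dot\sigma(f)\dot\sigma(f)^T],$$ with $\sigma,\dot\sigma$ applied entrywise. With $\Phi(x)=\frac{2}{1+e^{-x}}-1$, let the kernel matrix of the graph convolutional network with $d$ hidden layers be $$\Theta=\Big[\sum_{i=1}^{d+1}\Sigma_i\odot(SS^T)^{\odot(d+1-i)}\odot\Big(\bigodot_{j=i}^{d}\dot E_j\Big)\Big]\odot\mathbb{E}_{f\sim\mathcal N(0,\Sigma_{d+1})}[\dot\Phi(f)\dot\Phi(f)^T],$$ where $\odot$ is the entrywise product, $M^{\odot k}$ the $k$-fold entrywise power, and empty products have all entries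 equal to $1$. Put $$\kappa_0(x)=\tfrac1\pi\big(\pi-\arccos x\big),\qquad \kappa_1(x)=\tfrac1\pi\big(x(\pi-\arccos x)+\sqrt{1-x^2}\big),\qquad \rho_i(p,q)=\frac{(\Sigma_i)_{pq}}{\sqrt{(\Sigma_i)_{pp}(\Sigma_i)_{qq}}}.$$ Then every $\Sigma_i$ is positive semidefinite, the expectations defining $E_i$ and $\dot E_i$ are finite, and for all $i\ge1$ and all $p,q$: $$(E_i)_{pq}=\frac{c_\sigma}{2}\sqrt{(\Sigma_i)_{pp}(\Sigma_i)_{qq}}\;\kappa_1(\rho_i(p,q)),$$ where the right-hand side is read as $0$ if $(\Sigma_i)_{pp}(\Sigma_i)_{qq}=0$; and, if $(\Sigma_i)_{pp}>0$ and $(\Sigma_i)_{qq}>0$, $$(\dot E_i)_{pq}=\frac{c_\sigma}{2}\,\kappa_0(\rho_i(p,q)).$$ Consequently, for every $d\ge 0$ and all $p,q$ with $(\Sigma_j)_{pp},(\Sigma_j)_{qq}>0$ for $1\le j\le d$, $$\Theta_{pq}=\Big[\sum_{i=1}^{d+1}(\Sigma_i)_{pq}\big((SS^T)_{pq}\big)^{d+1-i}\prod_{j=i}^{d}\frac{c_\sigma}{2}\kappa_0(\rho_j(p,q))\Big]\,\mathbb{E}_{f\sim\mathcal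 N(0,\Sigma_{d+1})}[\dot\Phi(f_p)\dot\Phi(f_q)].$$ Finally, the natural normalisation constant $c_\sigma=\big(\mathbb{E}_{u\sim\mathcal N(0,1)}[\sigma(u)^2]\big)^{-1}$ for ReLU equals $2$. -/

import Mathlib

open MeasureTheory ProbabilityTheory

/-- The ReLU activation `x ↦ max(x, 0)`. -/
def relu (x : ℝ) : ℝ := max x 0

/-- The arc-cosine kernel of order zero. -/
noncomputable def kappa0 (x : ℝ) : ℝ := 1 / Real.pi * (Real.pi - Real.arccos x)

/-- The arc-cosine kernel of order one. -/
noncomputable def kappa1 (x : ℝ) : ℝ :=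
  1 / Real.pi * (x * (Real.pi - Real.arccos x) + Real.sqrt (1 - x ^ 2))

/-- The rescaled sigmoid `Φ : ℝ → (-1, 1)` at the output of the network. -/
noncomputable def Phi (x : ℝ) : ℝ := 2 / (1 + Real.exp (-x)) - 1

/-- The normalised off-diagonal entry (correlation) `Λ_pq / √(Λ_pp Λ_qq)`. -/
noncomputable def corr {n : ℕ} (Λ : Matrix (Fin n) (Fin n) ℝ) (p q : Fin n) : ℝ :=
  Λ p q / Real.sqrt (Λ p p * Λ q q)

/-- The matrix of second moments `𝔼_{f ∼ N(0, Λ)} [g(f) g(f)ᵀ]`, with `g` applied entrywise. -/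
noncomputable def gaussMoment {n : ℕ} (g : ℝ → ℝ) (Λ : Matrix (Fin n) (Fin n) ℝ) :
    Matrix (Fin n) (Fin n) ℝ :=
  Matrix.of fun p q => ∫ f, g (f p) * g (f q) ∂(multivariateGaussian 0 Λ)

/-- The covariance matrices `Σ_i` (`i ≥ 1`) between the nodes at layer `i` of a GCN with
activation `σ`, normalisation `c`, diffusion operator `S` and feature matrix `X`:
`Σ_1 = S X Xᵀ Sᵀ` and `Σ_{i+1} = S E_i Sᵀ` with `E_i = c 𝔼_{f ∼ N(0, Σ_i)} [σ(f) σ(f)ᵀ]`.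
The value at the unused index `0` is irrelevant. -/
noncomputable def layerCov {n m : ℕ} (σ : ℝ → ℝ) (c : ℝ) (S : Matrix (Fin n) (Fin n) ℝ)
    (X : Matrix (Fin n) (Fin m) ℝ) : ℕ → Matrix (Fin n) (Fin n) ℝ
  | 0 => 0
  | 1 => S * X * X.transpose * S.transpose
  | i + 2 => S * (c • gaussMoment σ (layerCov σ c S X (i + 1))) * S.transpose

/-- `E_i = c 𝔼_{f ∼ N(0, Σ_i)} [σ(f) σ(f)ᵀ]`. -/
noncomputable def layerE {n m : ℕ} (σ : ℝ → ℝ) (c : ℝ) (S : Matrix (Fin n) (Fin n) ℝ)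
    (X : Matrix (Fin n) (Fin m) ℝ) (i : ℕ) : Matrix (Fin n) (Fin n) ℝ :=
  c • gaussMoment σ (layerCov σ c S X i)

/-- `Ė_i = c 𝔼_{f ∼ N(0, Σ_i)} [σ'(f) σ'(f)ᵀ]`. -/
noncomputable def layerEdot {n m : ℕ} (σ : ℝ → ℝ) (c : ℝ) (S : Matrix (Fin n) (Fin n) ℝ)
    (X : Matrix (Fin n) (Fin m) ℝ) (i : ℕ) : Matrix (Fin n) (Fin n) ℝ :=
  c • gaussMoment (deriv σ) (layerCov σ c S X i)

/-- The kernel matrix `Θ` of the GCN with `d` hidden layers,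
`[∑_{i=1}^{d+1} Σ_i ⊙ (S Sᵀ)^{⊙(d+1-i)} ⊙ (Ė_i ⊙ ⋯ ⊙ Ė_d)] ⊙ 𝔼_{f ∼ N(0, Σ_{d+1})} [Φ'(f) Φ'(f)ᵀ]`,
entry by entry. -/
noncomputable def gcnKernel {n m : ℕ} (σ : ℝ → ℝ) (c : ℝ) (S : Matrix (Fin n) (Fin n) ℝ)
    (X : Matrix (Fin n) (Fin m) ℝ) (d : ℕ) : Matrix (Fin n) (Fin n) ℝ :=
  Matrix.of fun p q =>
    (∑ i ∈ Finset.Icc 1 (d + 1), layerCov σ c S X i p q *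
        (S * S.transpose) p q ^ (d + 1 - i) * ∏ j ∈ Finset.Icc i d, layerEdot σ c S X j p q) *
      gaussMoment (deriv Phi) (layerCov σ c S X (d + 1)) p q

/-- The natural normalisation constant `(𝔼_{u ∼ N(0, 1)} [σ(u)²])⁻¹` of an activation `σ`. -/
noncomputable def naturalConst (σ : ℝ → ℝ) : ℝ :=
  (∫ u, σ u ^ 2 ∂(gaussianReal 0 1))⁻¹

/-! Each entry depends only on the joint law of two coordinates. With `θ = arccos ρ`, the pair `(f
p, f q)` is distributed as `(a u, b (cos θ u + sin θ v))`, where `u, v` are independent standard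
Gaussians and `a, b` the standard deviations (`map_multivariateGaussian_eq_map_prod`).

ReLU is positively homogeneous of degree 1 and its derivative of degree 0, so the scales factor out
and polar coordinates split the integral into a radial moment and an angular integral of `g (cos φ)
* g (cos (φ - θ))`. The latter lives on an arc of length `π - θ`, where both cosines are positive;
integrating `1` or the product of cosines there gives `kappa0` or `kappa1`.

Positive semidefiniteness comes from Gram matrices, the kernel formula from entrywise substitution,
and the normalisation from `θ = 0`. -/

/-! ### ReLU and its derivative -/

theorem relu_nonneg (x : ℝ) : 0 ≤ relu x := le_max_right _ _

theorem continuous_relu : Continuous relu := by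
  unfold relu; fun_prop

theorem measurable_relu : Measurable relu := continuous_relu.measurable

theorem relu_mul_of_nonneg {a : ℝ} (ha : 0 ≤ a) (x : ℝ) : relu (a * x) = a * relu x := by
  unfold relu
  rw [mul_max_of_nonneg _ _ ha, mul_zero]

theorem relu_of_pos {x : ℝ} (hx : 0 < x) : relu x = x := max_eq_left hx.le

theorem relu_of_nonpos {x : ℝ} (hx : x ≤ 0) : relu x = 0 := max_eq_right hx

theorem abs_relu_le (x : ℝ) : |relu x| ≤ |x| := by
  rw [abs_of_nonneg (relu_nonneg x)]
  exact max_le (le_abs_self x) (abs_nonneg x)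

/-- At the kink, where `relu` is not differentiable, `deriv` takes the value `0`. -/
theorem deriv_relu (x : ℝ) : deriv relu x = if 0 < x then 1 else 0 := by
  rcases lt_trichotomy x 0 with hx | rfl | hx
  · have : relu =ᶠ[nhds x] fun _ => 0 := by
      filter_upwards [Iio_mem_nhds hx] with y hy using relu_of_nonpos (le_of_lt hy)
    rw [this.deriv_eq, deriv_const, if_neg hx.not_gt]
  · rw [if_neg (lt_irrefl _)]
    refine deriv_zero_of_not_differentiableAt fun h => not_differentiableAt_abs_zero ?_
    have : (abs : ℝ → ℝ) = fun x => 2 * relu x - x := by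
      funext x
      rcases le_total x 0 with hx | hx
      · rw [abs_of_nonpos hx, relu_of_nonpos hx]; ring
      · rw [abs_of_nonneg hx, relu, max_eq_left hx]; ring
    rw [this]
    exact (h.const_mul 2).sub differentiableAt_id
  · have : relu =ᶠ[nhds x] fun y => y := by
      filter_upwards [Ioi_mem_nhds hx] with y hy using relu_of_pos hy
    rw [this.deriv_eq, deriv_id'', if_pos hx]

/-- Homogeneity of degree 0 fails at `a = 0`, whence the positive variances required in the formula
for `layerEdot`. -/
theorem deriv_relu_mul_of_pos {a : ℝ} (ha : 0 < a) (x : ℝ) :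
    deriv relu (a * x) = deriv relu x := by
  simp only [deriv_relu, mul_pos_iff_of_pos_left ha]

/-! ### Planar Gaussian integrals -/

/-- Integration against a standard Gaussian on the plane in polar coordinates. -/
theorem integral_gaussianReal_prod_eq_polar (F : ℝ × ℝ → ℝ) :
    ∫ z, F z ∂((gaussianReal 0 1).prod (gaussianReal 0 1)) =
      ∫ p in Set.Ioi (0 : ℝ) ×ˢ Set.Ioo (-Real.pi) Real.pi,
        p.1 * ((2 * Real.pi)⁻¹ * Real.exp (-(1 / 2) * p.1 ^ 2) *
          F (p.1 * Real.cos p.2, p.1 * Real.sin p.2)) := by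
  have hdens : ∀ z : ℝ × ℝ, gaussianPDFReal 0 1 z.1 * gaussianPDFReal 0 1 z.2 =
      (2 * Real.pi)⁻¹ * Real.exp (-(1 / 2) * (z.1 ^ 2 + z.2 ^ 2)) := by
    intro z
    simp only [gaussianPDFReal, NNReal.coe_one, mul_one, sub_zero]
    rw [mul_mul_mul_comm, ← mul_inv, Real.mul_self_sqrt (by positivity), ← Real.exp_add]
    congr 2
    ring
  rw [gaussianReal_of_var_ne_zero 0 one_ne_zero,
    prod_withDensity (measurable_gaussianPDF 0 1) (measurable_gaussianPDF 0 1),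
    ← Measure.volume_eq_prod,
    integral_withDensity_eq_integral_toReal_smul
      (f := fun z : ℝ × ℝ => gaussianPDF 0 1 z.1 * gaussianPDF 0 1 z.2)
      (by fun_prop)
      (Filter.Eventually.of_forall fun z =>
        ENNReal.mul_lt_top gaussianPDF_lt_top gaussianPDF_lt_top)]
  simp only [ENNReal.toReal_mul, toReal_gaussianPDF, hdens, smul_eq_mul]
  rw [← integral_comp_polarCoord_symm]
  simp only [polarCoord_target, polarCoord_symm_apply, smul_eq_mul]
  refine setIntegral_congr_fun (measurableSet_Ioi.prod measurableSet_Ioo) fun p _ => ?_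
  rw [mul_pow, mul_pow, ← mul_add, Real.cos_sq_add_sin_sq, mul_one]

/-- Second moments of positively homogeneous functions of two correlated standard Gaussians
factor into a radial and an angular integral. -/
theorem integral_gaussianReal_prod_of_homogeneous {g : ℝ → ℝ} {k : ℕ}
    (hg : ∀ r x : ℝ, 0 < r → g (r * x) = r ^ k * g x) (θ : ℝ) :
    ∫ z, g z.1 * g (Real.cos θ * z.1 + Real.sin θ * z.2)
        ∂((gaussianReal 0 1).prod (gaussianReal 0 1)) =
      (2 * Real.pi)⁻¹ *
        (∫ r in Set.Ioi (0 : ℝ), r ^ (2 * k + 1) * Real.exp (-(1 / 2) * r ^ 2)) *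
        ∫ φ in Set.Ioo (-Real.pi) Real.pi, g (Real.cos φ) * g (Real.cos (φ - θ)) := by
  rw [integral_gaussianReal_prod_eq_polar, mul_assoc, ← setIntegral_prod_mul,
    ← Measure.volume_eq_prod, ← integral_const_mul]
  refine setIntegral_congr_fun (measurableSet_Ioi.prod measurableSet_Ioo) fun p hp => ?_
  have hr : 0 < p.1 := hp.1
  have h2 : Real.cos θ * (p.1 * Real.cos p.2) + Real.sin θ * (p.1 * Real.sin p.2) =
      p.1 * Real.cos (p.2 - θ) := by
    rw [Real.cos_sub]; ring
  dsimp only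
  rw [h2, hg _ _ hr, hg _ _ hr]
  ring

theorem integral_Ioi_mul_exp_neg_half_sq :
    ∫ r in Set.Ioi (0 : ℝ), r ^ (2 * 0 + 1) * Real.exp (-(1 / 2) * r ^ 2) = 1 := by
  have h := integral_rpow_mul_exp_neg_mul_rpow (p := 2) (q := 1) (b := 1 / 2)
    (by norm_num) (by norm_num) (by norm_num)
  norm_num [Real.rpow_neg] at h ⊢
  exact h

theorem integral_Ioi_cube_mul_exp_neg_half_sq :
    ∫ r in Set.Ioi (0 : ℝ), r ^ (2 * 1 + 1) * Real.exp (-(1 / 2) * r ^ 2) = 2 := by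
  -- The cast lets `Real.rpow_natCast` turn the real power into a natural one.
  have h := integral_rpow_mul_exp_neg_mul_rpow (p := 2) (q := ((3 : ℕ) : ℝ)) (b := 1 / 2)
    (by norm_num) (by norm_num) (by norm_num)
  simp only [Real.rpow_natCast, Real.rpow_two] at h
  norm_num [Real.rpow_neg] at h ⊢
  exact h

/-- If `g` vanishes on the nonpositive reals, only the angles at which both cosines are positive
contribute. -/
theorem integral_mul_cos_eq_intervalIntegral {g : ℝ → ℝ} (hg : ∀ x ≤ 0, g x = 0) {θ : ℝ}
    (h0 : 0 ≤ θ) (h1 : θ ≤ Real.pi) :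
    ∫ φ in Set.Ioo (-Real.pi) Real.pi, g (Real.cos φ) * g (Real.cos (φ - θ)) =
      ∫ φ in Set.Ioo (θ - Real.pi / 2) (Real.pi / 2),
        g (Real.cos φ) * g (Real.cos (φ - θ)) := by
  have hpi := Real.pi_pos
  refine (setIntegral_eq_of_subset_of_forall_sdiff_eq_zero measurableSet_Ioo
    (Set.Ioo_subset_Ioo (by linarith) (by linarith)) fun φ hφ => ?_)
  obtain ⟨⟨ha, hb⟩, hn⟩ := hφ
  simp only [Set.mem_Ioo, not_and_or, not_lt] at hn
  rcases hn with hn | hn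
  -- Left of the arc, either `cos φ ≤ 0`, or `φ > -π/2` and then `θ - φ` lies between `π/2` and
  -- `3π/2`.
  · by_cases hc : φ ≤ -(Real.pi / 2)
    · rw [hg (Real.cos φ), zero_mul]
      rw [← Real.cos_neg]
      exact Real.cos_nonpos_of_pi_div_two_le_of_le (by linarith) (by linarith)
    · rw [hg (Real.cos (φ - θ)), mul_zero]
      rw [← Real.cos_neg]
      exact Real.cos_nonpos_of_pi_div_two_le_of_le (by linarith) (by linarith)
  · rw [hg (Real.cos φ), zero_mul]
    exact Real.cos_nonpos_of_pi_div_two_le_of_le (by linarith) (by linarith)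

theorem cos_pos_and_cos_sub_pos {θ φ : ℝ} (h0 : 0 ≤ θ)
    (hφ : φ ∈ Set.Ioo (θ - Real.pi / 2) (Real.pi / 2)) :
    0 < Real.cos φ ∧ 0 < Real.cos (φ - θ) := by
  obtain ⟨ha, hb⟩ := hφ
  exact ⟨Real.cos_pos_of_mem_Ioo ⟨by linarith, by linarith⟩,
    Real.cos_pos_of_mem_Ioo ⟨by linarith, by linarith⟩⟩

theorem integral_deriv_relu_cos {θ : ℝ} (h0 : 0 ≤ θ) (h1 : θ ≤ Real.pi) :
    ∫ φ in Set.Ioo (-Real.pi) Real.pi, deriv relu (Real.cos φ) * deriv relu (Real.cos (φ - θ)) =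
      Real.pi - θ := by
  rw [integral_mul_cos_eq_intervalIntegral (fun x hx => by rw [deriv_relu, if_neg hx.not_gt]) h0 h1,
    setIntegral_congr_fun (g := fun _ => (1 : ℝ)) measurableSet_Ioo fun φ hφ => ?_]
  · rw [setIntegral_const, smul_eq_mul, mul_one, Real.volume_real_Ioo_of_le (by linarith)]
    ring
  · obtain ⟨ha, hb⟩ := cos_pos_and_cos_sub_pos h0 hφ
    simp only [deriv_relu, if_pos ha, if_pos hb, mul_one]

theorem integral_relu_cos {θ : ℝ} (h0 : 0 ≤ θ) (h1 : θ ≤ Real.pi) :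
    ∫ φ in Set.Ioo (-Real.pi) Real.pi, relu (Real.cos φ) * relu (Real.cos (φ - θ)) =
      (Real.cos θ * (Real.pi - θ) + Real.sin θ) / 2 := by
  rw [integral_mul_cos_eq_intervalIntegral (fun x hx => relu_of_nonpos hx) h0 h1,
    setIntegral_congr_fun (g := fun φ => Real.cos φ * Real.cos (φ - θ)) measurableSet_Ioo
      fun φ hφ => ?_,
    ← integral_Ioc_eq_integral_Ioo, ← intervalIntegral.integral_of_le (by linarith)]
  -- The antiderivative comes from `cos φ cos (φ - θ) = (cos θ + cos (2φ - θ)) / 2`.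
  · have hd : ∀ φ ∈ Set.uIcc (θ - Real.pi / 2) (Real.pi / 2),
        HasDerivAt (fun φ => φ * Real.cos θ / 2 + Real.sin (2 * φ - θ) / 4)
          (Real.cos φ * Real.cos (φ - θ)) φ := by
      intro φ _
      have h2 := (((hasDerivAt_id φ).const_mul 2).sub_const θ).sin.div_const 4
      have h3 := (((hasDerivAt_id φ).mul_const (Real.cos θ)).div_const 2).add h2
      refine h3.congr_deriv ?_
      have e1 : 2 * φ - θ = φ + (φ - θ) := by ring
      have e2 : Real.cos θ = Real.cos (φ - (φ - θ)) := by congr 1; ring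
      simp only [id_eq, e1]
      rw [e2, Real.cos_add, Real.cos_sub φ (φ - θ)]
      ring
    rw [intervalIntegral.integral_eq_sub_of_hasDerivAt hd
      (Continuous.intervalIntegrable (by fun_prop) _ _)]
    have e1 : Real.sin (2 * (Real.pi / 2) - θ) = Real.sin θ := by
      rw [mul_div_cancel₀ _ (two_ne_zero), Real.sin_pi_sub]
    have e2 : Real.sin (2 * (θ - Real.pi / 2) - θ) = -Real.sin θ := by
      rw [← Real.sin_sub_pi]; congr 1; ring
    rw [e1, e2]
    ring
  · obtain ⟨ha, hb⟩ := cos_pos_and_cos_sub_pos h0 hφ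
    simp only [relu_of_pos ha, relu_of_pos hb]

theorem integral_deriv_relu_gaussianReal_prod {θ : ℝ} (h0 : 0 ≤ θ) (h1 : θ ≤ Real.pi) :
    ∫ z, deriv relu z.1 * deriv relu (Real.cos θ * z.1 + Real.sin θ * z.2)
        ∂((gaussianReal 0 1).prod (gaussianReal 0 1)) = 1 / 2 * kappa0 (Real.cos θ) := by
  rw [integral_gaussianReal_prod_of_homogeneous (k := 0)
      (fun r x hr => by rw [deriv_relu_mul_of_pos hr, pow_zero, one_mul]),
    integral_Ioi_mul_exp_neg_half_sq, integral_deriv_relu_cos h0 h1, kappa0,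
    Real.arccos_cos h0 h1]
  field_simp

theorem integral_relu_gaussianReal_prod {θ : ℝ} (h0 : 0 ≤ θ) (h1 : θ ≤ Real.pi) :
    ∫ z, relu z.1 * relu (Real.cos θ * z.1 + Real.sin θ * z.2)
        ∂((gaussianReal 0 1).prod (gaussianReal 0 1)) = 1 / 2 * kappa1 (Real.cos θ) := by
  have hs : Real.sqrt (1 - Real.cos θ ^ 2) = Real.sin θ := by
    rw [← Real.sin_sq, Real.sqrt_sq (Real.sin_nonneg_of_nonneg_of_le_pi h0 h1)]
  rw [integral_gaussianReal_prod_of_homogeneous (k := 1)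
      (fun r x hr => by rw [relu_mul_of_nonneg hr.le, pow_one]),
    integral_Ioi_cube_mul_exp_neg_half_sq, integral_relu_cos h0 h1, kappa1,
    Real.arccos_cos h0 h1, hs]
  field_simp

/-- At `θ = 0` the two correlated variables coincide, and `kappa1 1 = 1`. -/
theorem integral_relu_sq_gaussianReal : ∫ u, relu u ^ 2 ∂(gaussianReal 0 1) = 1 / 2 := by
  have h := integral_relu_gaussianReal_prod le_rfl Real.pi_pos.le
  simp only [Real.cos_zero, Real.sin_zero, one_mul, zero_mul, add_zero, ← sq] at h
  rw [integral_fun_fst (fun u => relu u ^ 2)] at h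
  simpa [kappa1, Real.pi_ne_zero] using h

/-! ### Two coordinates of a Gaussian vector -/

/-- The joint law of two coordinates of a centred Gaussian vector, as a linear image of two
independent standard Gaussians. -/
theorem map_multivariateGaussian_eq_map_prod {n : ℕ} {Λ : Matrix (Fin n) (Fin n) ℝ}
    (hΛ : Λ.PosSemidef) {p q : Fin n} {a b θ : ℝ} (ha : a ^ 2 = Λ p p) (hb : b ^ 2 = Λ q q)
    (hab : a * b * Real.cos θ = Λ p q) :
    (multivariateGaussian 0 Λ).map (fun f : EuclideanSpace ℝ (Fin n) => (f p, f q)) =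
      ((gaussianReal 0 1).prod (gaussianReal 0 1)).map
        (fun z => (a * z.1, b * (Real.cos θ * z.1 + Real.sin θ * z.2))) := by
  have hm1 : Measurable (fun f : EuclideanSpace ℝ (Fin n) => (f p, f q)) := by fun_prop
  have hm2 : Measurable
      (fun z : ℝ × ℝ => (a * z.1, b * (Real.cos θ * z.1 + Real.sin θ * z.2))) := by fun_prop
  have := Measure.isProbabilityMeasure_map (μ := multivariateGaussian 0 Λ) hm1.aemeasurable
  have := Measure.isProbabilityMeasure_map
    (μ := (gaussianReal 0 1).prod (gaussianReal 0 1)) hm2.aemeasurable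
  refine Measure.ext_of_charFunDual (funext fun L => ?_)
  have hL : ∀ x y : ℝ, L (x, y) = L (1, 0) * x + L (0, 1) * y := by
    intro x y
    have : ((x, y) : ℝ × ℝ) = x • ((1, 0) : ℝ × ℝ) + y • ((0, 1) : ℝ × ℝ) := by simp
    rw [this, map_add, map_smul, map_smul, smul_eq_mul, smul_eq_mul]
    ring
  generalize L (1, 0) = s at hL
  generalize L (0, 1) = t at hL
  rw [charFunDual_apply, charFunDual_apply, integral_map hm1.aemeasurable (by fun_prop),
    integral_map hm2.aemeasurable (by fun_prop)]
  have hsymm : Λ q p = Λ p q := by simpa using hΛ.isHermitian.apply p q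
  -- Evaluated at `s e_p + t e_q`, this is the characteristic function of the pair at `(s, t)`; the
  -- sum of basis vectors also covers `p = q`.
  have h1 := charFun_multivariateGaussian (μ := 0) hΛ
    (EuclideanSpace.single p s + EuclideanSpace.single q t)
  have hquad : (EuclideanSpace.single p s + EuclideanSpace.single q t : EuclideanSpace ℝ (Fin n)) ⬝ᵥ
      Λ.mulVec (EuclideanSpace.single p s + EuclideanSpace.single q t :
        EuclideanSpace ℝ (Fin n)) =
      s ^ 2 * Λ p p + 2 * s * t * Λ p q + t ^ 2 * Λ q q := by
    simp [Matrix.mulVec_add, Matrix.mulVec_single, hsymm]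
    ring
  rw [charFun_apply, hquad] at h1
  simp only [inner_add_right, EuclideanSpace.inner_single_right, inner_zero_right] at h1
  have h2 : ∀ A B : ℝ, ∫ z : ℝ × ℝ, Complex.exp (((A * z.1 + B * z.2 : ℝ) : ℂ) * Complex.I)
      ∂((gaussianReal 0 1).prod (gaussianReal 0 1)) =
      Complex.exp (-((A ^ 2 + B ^ 2 : ℝ) : ℂ) / 2) := by
    intro A B
    have e : ∀ z : ℝ × ℝ, Complex.exp (((A * z.1 + B * z.2 : ℝ) : ℂ) * Complex.I) =
        Complex.exp (A * z.1 * Complex.I) * Complex.exp (B * z.2 * Complex.I) := by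
      intro z
      rw [← Complex.exp_add]
      push_cast
      ring_nf
    simp only [e]
    rw [integral_prod_mul (fun x : ℝ => Complex.exp (A * x * Complex.I))
      (fun x : ℝ => Complex.exp (B * x * Complex.I)), ← charFun_apply_real, ← charFun_apply_real,
      charFun_gaussianReal, charFun_gaussianReal, ← Complex.exp_add]
    push_cast
    ring_nf
  have h3 := h2 (s * a + t * b * Real.cos θ) (t * b * Real.sin θ)
  have e1 : ∀ f : EuclideanSpace ℝ (Fin n), L (f p, f q) = s * f p + t * f q := fun f => hL _ _
  have e2 : ∀ z : ℝ × ℝ, L (a * z.1, b * (Real.cos θ * z.1 + Real.sin θ * z.2)) =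
      (s * a + t * b * Real.cos θ) * z.1 + t * b * Real.sin θ * z.2 := by
    intro z; rw [hL]; ring
  have e3 : (s * a + t * b * Real.cos θ) ^ 2 + (t * b * Real.sin θ) ^ 2 =
      s ^ 2 * Λ p p + 2 * s * t * Λ p q + t ^ 2 * Λ q q := by
    rw [← ha, ← hb, ← hab]
    linear_combination t ^ 2 * b ^ 2 * Real.sin_sq_add_cos_sq θ
  simp only [e1, e2]
  rw [h3, e3]
  convert h1 using 2
  · simp
  · simp only [Complex.ofReal_zero, zero_mul, zero_sub, neg_div]

/-- The 2×2 submatrix on `p, q` is positive semidefinite, even when `p = q`, so its determinant is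
nonnegative. -/
theorem sq_apply_le_mul_diag {n : ℕ} {Λ : Matrix (Fin n) (Fin n) ℝ} (hΛ : Λ.PosSemidef)
    (p q : Fin n) : Λ p q ^ 2 ≤ Λ p p * Λ q q := by
  have hsymm : Λ q p = Λ p q := by simpa using hΛ.isHermitian.apply p q
  have h := (hΛ.submatrix ![p, q]).det_nonneg
  rw [Matrix.det_fin_two] at h
  simp [hsymm] at h
  linarith [sq (Λ p q)]

theorem cos_arccos_corr {n : ℕ} {Λ : Matrix (Fin n) (Fin n) ℝ} (hΛ : Λ.PosSemidef)
    (p q : Fin n) : Real.cos (Real.arccos (corr Λ p q)) = corr Λ p q := by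
  have h : |corr Λ p q| ≤ 1 := by
    rw [corr, abs_div, abs_of_nonneg (Real.sqrt_nonneg _)]
    exact div_le_one_of_le₀ (Real.abs_le_sqrt (sq_apply_le_mul_diag hΛ p q)) (Real.sqrt_nonneg _)
  exact Real.cos_arccos (abs_le.1 h).1 (abs_le.1 h).2

theorem sqrt_mul_corr {n : ℕ} {Λ : Matrix (Fin n) (Fin n) ℝ} (hΛ : Λ.PosSemidef)
    (p q : Fin n) : Real.sqrt (Λ p p * Λ q q) * corr Λ p q = Λ p q := by
  have h := Real.abs_le_sqrt (sq_apply_le_mul_diag hΛ p q)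
  -- In the degenerate case Cauchy–Schwarz forces the covariance to vanish too.
  rcases eq_or_ne (Real.sqrt (Λ p p * Λ q q)) 0 with h0 | h0
  · rw [h0] at h
    rw [h0, zero_mul, abs_nonpos_iff.1 h]
  · rw [corr, mul_div_cancel₀ _ h0]

theorem gaussMoment_apply_eq_integral_prod {n : ℕ} {Λ : Matrix (Fin n) (Fin n) ℝ}
    (hΛ : Λ.PosSemidef) {g : ℝ → ℝ} (hg : Measurable g) (p q : Fin n) :
    gaussMoment g Λ p q =
      ∫ z, g (Real.sqrt (Λ p p) * z.1) * g (Real.sqrt (Λ q q) *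
          (Real.cos (Real.arccos (corr Λ p q)) * z.1 + Real.sin (Real.arccos (corr Λ p q)) * z.2))
        ∂((gaussianReal 0 1).prod (gaussianReal 0 1)) := by
  have hmap := map_multivariateGaussian_eq_map_prod hΛ (p := p) (q := q)
    (θ := Real.arccos (corr Λ p q)) (Real.sq_sqrt hΛ.diag_nonneg) (Real.sq_sqrt hΛ.diag_nonneg)
    (by rw [← Real.sqrt_mul hΛ.diag_nonneg, cos_arccos_corr hΛ, sqrt_mul_corr hΛ])
  have hG : Measurable fun z : ℝ × ℝ => g z.1 * g z.2 := by fun_prop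
  have h := congrArg (fun μ => ∫ z, g z.1 * g z.2 ∂μ) hmap
  dsimp only at h
  rwa [integral_map (by fun_prop) hG.aestronglyMeasurable,
    integral_map (by fun_prop) hG.aestronglyMeasurable] at h

/-- Zero variances are included: `relu_mul_of_nonneg` allows a zero scale, and both sides then
vanish. -/
theorem gaussMoment_relu_apply {n : ℕ} {Λ : Matrix (Fin n) (Fin n) ℝ} (hΛ : Λ.PosSemidef)
    (p q : Fin n) :
    gaussMoment relu Λ p q = 1 / 2 * Real.sqrt (Λ p p * Λ q q) * kappa1 (corr Λ p q) := by
  have h := integral_relu_gaussianReal_prod (Real.arccos_nonneg (corr Λ p q))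
    (Real.arccos_le_pi (corr Λ p q))
  rw [gaussMoment_apply_eq_integral_prod hΛ measurable_relu]
  have e : ∀ a b x y : ℝ, 0 ≤ a → 0 ≤ b →
      relu (a * x) * relu (b * y) = a * b * (relu x * relu y) := by
    intro a b x y ha hb
    rw [relu_mul_of_nonneg ha, relu_mul_of_nonneg hb]
    ring
  simp only [e _ _ _ _ (Real.sqrt_nonneg (Λ p p)) (Real.sqrt_nonneg (Λ q q))]
  rw [integral_const_mul, h, cos_arccos_corr hΛ, Real.sqrt_mul hΛ.diag_nonneg]
  ring

theorem gaussMoment_deriv_relu_apply {n : ℕ} {Λ : Matrix (Fin n) (Fin n) ℝ}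
    (hΛ : Λ.PosSemidef) {p q : Fin n} (hp : 0 < Λ p p) (hq : 0 < Λ q q) :
    gaussMoment (deriv relu) Λ p q = 1 / 2 * kappa0 (corr Λ p q) := by
  have h := integral_deriv_relu_gaussianReal_prod (Real.arccos_nonneg (corr Λ p q))
    (Real.arccos_le_pi (corr Λ p q))
  rw [gaussMoment_apply_eq_integral_prod hΛ (measurable_deriv relu)]
  simp only [deriv_relu_mul_of_pos (Real.sqrt_pos.2 hp), deriv_relu_mul_of_pos (Real.sqrt_pos.2 hq)]
  rw [h, cos_arccos_corr hΛ]

/-! ### Integrability and positive semidefiniteness -/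

theorem memLp_relu_eval_multivariateGaussian {n : ℕ} (Λ : Matrix (Fin n) (Fin n) ℝ) (p : Fin n) :
    MemLp (fun f : EuclideanSpace ℝ (Fin n) => relu (f p)) 2 (multivariateGaussian 0 Λ) := by
  have h := IsGaussian.memLp_dual (multivariateGaussian 0 Λ)
    (EuclideanSpace.proj p : EuclideanSpace ℝ (Fin n) →L[ℝ] ℝ) 2 (by norm_num)
  exact h.mono (continuous_relu.comp (by fun_prop)).aestronglyMeasurable
    (Filter.Eventually.of_forall fun f => abs_relu_le (f p))

theorem integrable_relu_mul_relu {n : ℕ} (Λ : Matrix (Fin n) (Fin n) ℝ) (p q : Fin n) :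
    Integrable (fun f : EuclideanSpace ℝ (Fin n) => relu (f p) * relu (f q))
      (multivariateGaussian 0 Λ) :=
  (memLp_relu_eval_multivariateGaussian Λ p).integrable_mul
    (memLp_relu_eval_multivariateGaussian Λ q)

theorem integrable_deriv_relu_mul_deriv_relu {n : ℕ} (Λ : Matrix (Fin n) (Fin n) ℝ)
    (p q : Fin n) :
    Integrable (fun f : EuclideanSpace ℝ (Fin n) => deriv relu (f p) * deriv relu (f q))
      (multivariateGaussian 0 Λ) := by
  refine Integrable.of_bound (C := 1) ?_ (Filter.Eventually.of_forall fun f => ?_)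
  · exact (((measurable_deriv relu).comp (by fun_prop)).mul
      ((measurable_deriv relu).comp (by fun_prop))).aestronglyMeasurable
  · simp only [deriv_relu]
    split_ifs <;> norm_num

/-- A matrix of second moments is a Gram matrix. -/
theorem posSemidef_gaussMoment {n : ℕ} {g : ℝ → ℝ} {Λ : Matrix (Fin n) (Fin n) ℝ}
    (hint : ∀ p q, Integrable (fun f : EuclideanSpace ℝ (Fin n) => g (f p) * g (f q))
      (multivariateGaussian 0 Λ)) : (gaussMoment g Λ).PosSemidef := by
  refine Matrix.PosSemidef.of_dotProduct_mulVec_nonneg ?_ fun x => ?_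
  · ext p q
    simp [gaussMoment, mul_comm]
  · have h : star x ⬝ᵥ (gaussMoment g Λ).mulVec x =
        ∫ f : EuclideanSpace ℝ (Fin n), (∑ p, x p * g (f p)) ^ 2 ∂(multivariateGaussian 0 Λ) := by
      have e : ∀ f : EuclideanSpace ℝ (Fin n), (∑ p, x p * g (f p)) ^ 2 =
          ∑ p, ∑ q, x p * x q * (g (f p) * g (f q)) := by
        intro f
        rw [sq, Finset.sum_mul_sum]
        exact Finset.sum_congr rfl fun p _ => Finset.sum_congr rfl fun q _ => by ring
      simp only [e]
      rw [integral_finsetSum _ fun p _ =>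
        integrable_finsetSum _ fun q _ => (hint p q).const_mul _]
      simp only [dotProduct, Matrix.mulVec, Finset.mul_sum, star_trivial]
      refine Finset.sum_congr rfl fun p _ => ?_
      rw [integral_finsetSum _ fun q _ => (hint p q).const_mul _]
      refine Finset.sum_congr rfl fun q _ => ?_
      rw [integral_const_mul]
      simp only [gaussMoment, Matrix.of_apply]
      ring
    rw [h]
    exact integral_nonneg fun f => sq_nonneg _

/-- No induction is needed: second moments form a Gram matrix whatever `Λ` is, and `S * _ * Sᵀ`
preserves positivity. -/
theorem posSemidef_layerCov_relu {n m : ℕ} {c : ℝ} (hc : 0 ≤ c) (S : Matrix (Fin n) (Fin n) ℝ)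
    (X : Matrix (Fin n) (Fin m) ℝ) (i : ℕ) : (layerCov relu c S X i).PosSemidef := by
  match i with
  | 0 => exact Matrix.PosSemidef.zero
  | 1 =>
    have h := Matrix.posSemidef_self_mul_conjTranspose (S * X)
    rw [Matrix.conjTranspose_eq_transpose_of_trivial, Matrix.transpose_mul] at h
    simpa only [layerCov, Matrix.mul_assoc] using h
  | i + 2 =>
    have h := ((posSemidef_gaussMoment (integrable_relu_mul_relu
      (layerCov relu c S X (i + 1)))).smul hc).mul_mul_conjTranspose_same S
    rwa [Matrix.conjTranspose_eq_transpose_of_trivial] at h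

/-! ### The kernel formulas -/

theorem corollary2 :
    (∀ (n m : ℕ) (S : Matrix (Fin n) (Fin n) ℝ) (X : Matrix (Fin n) (Fin m) ℝ) (c : ℝ), 0 ≤ c →
      (∀ i : ℕ, 1 ≤ i →
        (layerCov relu c S X i).PosSemidef ∧
        ∀ p q : Fin n,
          (Integrable (fun f : EuclideanSpace ℝ (Fin n) => relu (f p) * relu (f q))
              (multivariateGaussian 0 (layerCov relu c S X i)) ∧
            layerE relu c S X i p q =
              c / 2 * Real.sqrt (layerCov relu c S X i p p * layerCov relu c S X i q q) *
                kappa1 (corr (layerCov relu c S X i) p q)) ∧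
          (Integrable (fun f : EuclideanSpace ℝ (Fin n) => deriv relu (f p) * deriv relu (f q))
              (multivariateGaussian 0 (layerCov relu c S X i)) ∧
            (0 < layerCov relu c S X i p p → 0 < layerCov relu c S X i q q →
              layerEdot relu c S X i p q =
                c / 2 * kappa0 (corr (layerCov relu c S X i) p q)))) ∧
      (∀ (d : ℕ) (p q : Fin n),
        (∀ j : ℕ, 1 ≤ j → j ≤ d →
          0 < layerCov relu c S X j p p ∧ 0 < layerCov relu c S X j q q) →
        gcnKernel relu c S X d p q =
          (∑ i ∈ Finset.Icc 1 (d + 1), layerCov relu c S X i p q *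
              (S * S.transpose) p q ^ (d + 1 - i) *
              ∏ j ∈ Finset.Icc i d, (c / 2 * kappa0 (corr (layerCov relu c S X j) p q))) *
            ∫ f, deriv Phi (f p) * deriv Phi (f q)
              ∂(multivariateGaussian 0 (layerCov relu c S X (d + 1))))) ∧
    Integrable (fun u : ℝ => relu u ^ 2) (gaussianReal 0 1) ∧ naturalConst relu = 2 := by
  have hEdot : ∀ (n m : ℕ) (S : Matrix (Fin n) (Fin n) ℝ) (X : Matrix (Fin n) (Fin m) ℝ) (c : ℝ),
      0 ≤ c → ∀ (i : ℕ) (p q : Fin n), 0 < layerCov relu c S X i p p →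
      0 < layerCov relu c S X i q q →
      layerEdot relu c S X i p q = c / 2 * kappa0 (corr (layerCov relu c S X i) p q) := by
    intro n m S X c hc i p q hp hq
    rw [layerEdot, Matrix.smul_apply,
      gaussMoment_deriv_relu_apply (posSemidef_layerCov_relu hc S X i) hp hq, smul_eq_mul]
    ring
  refine ⟨fun n m S X c hc => ⟨fun i _ => ⟨posSemidef_layerCov_relu hc S X i, fun p q =>
    ⟨⟨integrable_relu_mul_relu _ p q, ?_⟩, integrable_deriv_relu_mul_deriv_relu _ p q,
      hEdot n m S X c hc i p q⟩⟩, fun d p q hpos => ?_⟩, ?_, ?_⟩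
  · rw [layerE, Matrix.smul_apply, gaussMoment_relu_apply (posSemidef_layerCov_relu hc S X i),
      smul_eq_mul]
    ring
  · simp only [gcnKernel, gaussMoment, Matrix.of_apply]
    congr 1
    refine Finset.sum_congr rfl fun i hi => ?_
    congr 1
    refine Finset.prod_congr rfl fun j hj => ?_
    rw [Finset.mem_Icc] at hi hj
    -- Only layers `j ≤ d` enter the product, so the variances at layer `d + 1` may vanish.
    obtain ⟨hp, hq⟩ := hpos j (hi.1.trans hj.1) hj.2
    exact hEdot n m S X c hc j p q hp hq
  · refine MemLp.integrable_sq ?_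
    exact (memLp_id_gaussianReal 2).mono measurable_relu.aestronglyMeasurable
      (Filter.Eventually.of_forall abs_relu_le)
  · rw [naturalConst, integral_relu_sq_gaussianReal]
    norm_num
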